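/- Let $m,n,k\ge 0$ be integers, let $A,\tilde A\in\mathbb{Z}^{m\times n}$, $U\in\mathbb{Z}^{m\times k}$ and $W\in\{0,\pm1\}^{k\times n}$ satisfy $A=\tilde A+UW$, and suppose that the stacked matrix $\begin{bmatrix}\tilde A\\ W\end{bmatrix}$ is totally unimodular (every square submatrix has determinant $0$, $1$ or $-1$). Let $b\in\mathbb{Z}^m$, $\ell\in(\mathbb{Z}\cup\{-\infty\})^n$ and $u\in(\mathbb{Z}\cup\{\infty\})^n$ with $\ell\le u$, and put $P=\{x\in\mathbb{R}^n : \ell\le x\le u,\ Ax\le b\}$. Then $$S=\operatorname{conv}\{x\in\mathbb{R}^n : \ell\le x\le u,\ Ax\le b,\ Wx\in\mathbb{Z}^k\}$$ is an integral polyhedron, that is, $S$ is the solution set of finitely many linear inequalities and $S=\operatorname{conv}(S\cap\mathbb{Z}^n)$. Moreover, $$\operatorname{conv}(P\cap\mathbb{Z}^n)=\operatorname{conv}\{x\in P : Wx\in\mathbb{Z}^k\}.$$ -/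

import Mathlib

namespace AffineTU

/-- `A = Ã + U W` is a `k`-row affine TU decomposition of the integral matrix `A`: the entries of
`W` lie in `{0, 1, -1}` and the stacked matrix `[Ã; W]` is totally unimodular. -/
structure IsAffineTUDecomposition {m n k : ℕ} (A At : Matrix (Fin m) (Fin n) ℤ)
    (U : Matrix (Fin m) (Fin k) ℤ) (W : Matrix (Fin k) (Fin n) ℤ) : Prop where
  eq_add_mul : A = At + U * W
  entries : ∀ i j, W i j = 0 ∨ W i j = 1 ∨ W i j = -1
  totallyUnimodular : (Matrix.fromRows At W).IsTotallyUnimodular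

/-- The set `ℤⁿ` of integral vectors in `ℝⁿ`. -/
def intVectors (n : ℕ) : Set (Fin n → ℝ) :=
  {x | ∀ i, ∃ z : ℤ, x i = (z : ℝ)}

/-- The action `M x` of an integral matrix on a real vector. -/
def act {m n : ℕ} (M : Matrix (Fin m) (Fin n) ℤ) (x : Fin n → ℝ) : Fin m → ℝ :=
  Matrix.mulVec (M.map (fun z : ℤ => (z : ℝ))) x

/-- A polyhedron in `ℝⁿ`: the solution set of finitely many linear inequalities. -/
def IsPolyhedron {n : ℕ} (S : Set (Fin n → ℝ)) : Prop :=
  ∃ (r : ℕ) (M : Matrix (Fin r) (Fin n) ℝ) (c : Fin r → ℝ), S = {x | Matrix.mulVec M x ≤ c}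

/-- An integral polyhedron: a polyhedron `S` with `S = conv (S ∩ ℤⁿ)`. -/
def IsIntegralPolyhedron {n : ℕ} (S : Set (Fin n → ℝ)) : Prop :=
  IsPolyhedron S ∧ S = convexHull ℝ (S ∩ intVectors n)

/-- `ℓ ≤ u` for `ℓ ∈ (ℤ ∪ {-∞})ⁿ` and `u ∈ (ℤ ∪ {∞})ⁿ`. -/
def BoundsLE {n : ℕ} (l : Fin n → WithBot ℤ) (u : Fin n → WithTop ℤ) : Prop :=
  ∀ i, ∀ a c : ℤ, l i = (a : WithBot ℤ) → u i = (c : WithTop ℤ) → a ≤ c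

/-- `P = {x ∈ ℝⁿ | ℓ ≤ x ≤ u, A x ≤ b}`; infinite bounds impose no condition. -/
def feasible {m n : ℕ} (A : Matrix (Fin m) (Fin n) ℤ) (b : Fin m → ℤ)
    (l : Fin n → WithBot ℤ) (u : Fin n → WithTop ℤ) : Set (Fin n → ℝ) :=
  {x | (∀ i, ∀ a : ℤ, l i = (a : WithBot ℤ) → (a : ℝ) ≤ x i) ∧
    (∀ i, ∀ c : ℤ, u i = (c : WithTop ℤ) → x i ≤ (c : ℝ)) ∧
    ∀ j, act A x j ≤ (b j : ℝ)}

end AffineTU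

/-!
The theorem has two halves.

*Integrality.* Let `x ∈ P` with `W x` integral. The matrix `[Ã; W; I]` is totally unimodular, and
`x` is a convex combination of integral vectors `y` at which each row of this matrix takes a value
between the floor and the ceiling of its value at `x` (`mem_convexHull_roundings`). Such a `y`
satisfies every integral bound on these rows that `x` satisfies, and `W y = W x`; hence
`ℓ ≤ y ≤ u` and `Ã y ≤ b - U W x`, that is, `A y ≤ b` (`roundings_subset_feasible`). This gives
`conv (P ∩ ℤⁿ) = conv {x ∈ P | W x ∈ ℤᵏ}`. The roundings of `x` form a compact convex set, to which
the Krein–Milman theorem applies. An extreme point `y` is integral: no nonzero direction is killed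
by all rows that are integral at `y`, so these rows contain a nonsingular square submatrix, whose
determinant is `±1`.

*Polyhedrality.* `conv (P ∩ ℤⁿ)` is a polyhedron by Meyer's theorem
(`isPolyhedral_convexHull_solutions`). By Gordan's lemma, the integral points `(x, t)`, `t ≥ 0`, of
the homogenized system `C x ≤ t d` form a finitely generated monoid. The generators with `t ≤ 1`
already generate all its elements with `t ≤ 1`, and the section at `t = 1` of the real cone that
they span is the integer hull. This cone is polyhedral by Weyl's theorem
(`isPolyhedral_span_finset`), proved by Fourier–Motzkin elimination, one generator at a time.
-/

namespace AffineTU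

open Matrix
open scoped NNReal

/-! ### Rounding for totally unimodular matrices -/

/-- Multiplication of a real vector by an integral matrix with arbitrary row index; `act` is the
case of rows indexed by `Fin m`. -/
def realMulVec {ι : Type*} {n : ℕ} (M : Matrix ι (Fin n) ℤ) : (Fin n → ℝ) →ₗ[ℝ] (ι → ℝ) :=
  (M.map (fun z : ℤ => (z : ℝ))).mulVecLin

lemma realMulVec_apply {ι : Type*} {n : ℕ} (M : Matrix ι (Fin n) ℤ) (x : Fin n → ℝ) (i : ι) :
    realMulVec M x i = ∑ j, (M i j : ℝ) * x j := by
  simp [realMulVec, mulVec, dotProduct]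

lemma act_eq_realMulVec {m n : ℕ} (M : Matrix (Fin m) (Fin n) ℤ) (x : Fin n → ℝ) :
    act M x = realMulVec M x := rfl

lemma realMulVec_intCast {ι : Type*} {n : ℕ} (M : Matrix ι (Fin n) ℤ) (x : Fin n → ℤ) (i : ι) :
    realMulVec M (fun j => (x j : ℝ)) i = ((M *ᵥ x) i : ℤ) := by
  simp [realMulVec_apply, mulVec, dotProduct]

lemma mem_intVectors_iff {n : ℕ} {x : Fin n → ℝ} :
    x ∈ intVectors n ↔ ∃ z : Fin n → ℤ, x = fun i => (z i : ℝ) := by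
  constructor
  · intro h
    choose z hz using h
    exact ⟨z, funext hz⟩
  · rintro ⟨z, rfl⟩ i
    exact ⟨z i, rfl⟩

/-- Cramer's rule: a unimodular integral system has integral solutions. -/
lemma mem_intVectors_of_isUnit_det {n : ℕ} (N : Matrix (Fin n) (Fin n) ℤ) (hN : IsUnit N.det)
    (y : Fin n → ℝ) (hy : realMulVec N y ∈ intVectors n) : y ∈ intVectors n := by
  obtain ⟨z, hz⟩ := mem_intVectors_iff.1 hy
  refine mem_intVectors_iff.2 ⟨N⁻¹ *ᵥ z, ?_⟩
  have h : realMulVec N⁻¹ (realMulVec N y) = y := by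
    simp only [realMulVec, mulVecLin_apply, mulVec_mulVec]
    have : (N⁻¹.map fun z : ℤ => (z : ℝ)) * (N.map fun z : ℤ => (z : ℝ)) = 1 := by
      have := congrArg (fun A : Matrix (Fin n) (Fin n) ℤ => A.map (Int.castRingHom ℝ))
        (nonsing_inv_mul N hN)
      rw [Matrix.map_mul, Matrix.map_one _ (map_zero _) (map_one _)] at this
      exact this
    rw [this, one_mulVec]
  rw [← h, hz]
  exact funext (realMulVec_intCast N⁻¹ z)

/-- If the rows of a totally unimodular matrix `M` on which `M y` is integral have trivial common
kernel, then they contain a nonsingular, hence unimodular, square submatrix, so `y` is integral. -/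
lemma mem_intVectors_of_ker_eq_zero {ι : Type*} {n : ℕ} {M : Matrix ι (Fin n) ℤ}
    (hM : M.IsTotallyUnimodular) (y : Fin n → ℝ)
    (hker : ∀ d, (∀ i, (∃ z : ℤ, realMulVec M y i = z) → realMulVec M d i = 0) → d = 0) :
    y ∈ intVectors n := by
  let v : {i // ∃ z : ℤ, realMulVec M y i = z} → (Fin n → ℝ) := fun i j => (M i j : ℝ)
  have hv : Submodule.span ℝ (Set.range v) = ⊤ := by
    by_contra hne
    obtain ⟨f, hf0, hf⟩ := Submodule.exists_le_ker_of_lt_top _ (lt_top_iff_ne_top.2 hne)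
    have hfx : ∀ x, f x = ∑ j, x j * f (Pi.single j 1) := fun x => by
      conv_lhs => rw [pi_eq_sum_univ' x]
      simp
    have hd := hker (fun j => f (Pi.single j 1)) fun i hi => by
      have : f (v ⟨i, hi⟩) = 0 := hf (Submodule.subset_span ⟨_, rfl⟩)
      rw [hfx] at this
      simpa [realMulVec_apply] using this
    refine hf0 (LinearMap.ext fun x => ?_)
    rw [hfx]
    simp [fun j => congrFun hd j]
  obtain ⟨κ, a, -, hspan, hli⟩ := exists_linearIndependent' ℝ v
  let B : Module.Basis κ ℝ (Fin n → ℝ) := Module.Basis.mk hli (by rw [hspan, hv])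
  let e : Fin n ≃ κ := (Pi.basisFun ℝ (Fin n)).indexEquiv B
  let N : Matrix (Fin n) (Fin n) ℤ := M.submatrix (fun i => (a (e i)).1) id
  refine mem_intVectors_of_isUnit_det N ?_ y fun i => ?_
  · have hrow : LinearIndependent ℝ (N.map (Int.castRingHom ℝ)).row := hli.comp e e.injective
    have hdet : (N.map (Int.castRingHom ℝ)).det ≠ 0 :=
      ((isUnit_iff_isUnit_det _).1 (linearIndependent_rows_iff_isUnit.1 hrow)).ne_zero
    rw [← RingHom.mapMatrix_apply, ← RingHom.map_det] at hdet
    have hN : N.det ≠ 0 := fun h => hdet (by rw [h]; simp)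
    obtain ⟨s, hs⟩ := (isTotallyUnimodular_iff M).1 hM n (fun i => (a (e i)).1) id
    change _ = N.det at hs
    rw [← hs] at hN ⊢
    cases s
    · exact absurd rfl hN
    · exact isUnit_one.neg
    · exact isUnit_one
  · obtain ⟨z, hz⟩ := (a (e i)).2
    refine ⟨z, ?_⟩
    rw [← hz]
    simp [realMulVec_apply, N]

/-- The vectors `y` such that `M y` lies between `⌊M x⌋` and `⌈M x⌉`. They satisfy every two-sided
system `c ≤ M y ≤ d` with integral bounds that `x` satisfies. -/
def roundings {ι : Type*} {n : ℕ} (M : Matrix ι (Fin n) ℤ) (x : Fin n → ℝ) : Set (Fin n → ℝ) :=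
  {y | ∀ i, (⌊realMulVec M x i⌋ : ℝ) ≤ realMulVec M y i ∧
    realMulVec M y i ≤ (⌈realMulVec M x i⌉ : ℝ)}

lemma self_mem_roundings {ι : Type*} {n : ℕ} (M : Matrix ι (Fin n) ℤ) (x : Fin n → ℝ) :
    x ∈ roundings M x := fun _ => ⟨Int.floor_le _, Int.le_ceil _⟩

lemma convex_roundings {ι : Type*} {n : ℕ} (M : Matrix ι (Fin n) ℤ) (x : Fin n → ℝ) :
    Convex ℝ (roundings M x) := by
  have : roundings M x = realMulVec M ⁻¹' (Set.Icc (fun i => (⌊realMulVec M x i⌋ : ℝ))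
      (fun i => (⌈realMulVec M x i⌉ : ℝ))) := by
    ext y
    simp [roundings, Pi.le_def, forall_and]
  rw [this]
  exact (convex_Icc _ _).linear_preimage _

lemma isClosed_roundings {ι : Type*} {n : ℕ} (M : Matrix ι (Fin n) ℤ) (x : Fin n → ℝ) :
    IsClosed (roundings M x) := by
  have hc : ∀ i, Continuous fun y => realMulVec M y i := fun i => by
    simp only [realMulVec_apply]
    fun_prop
  simp only [roundings, Set.ofPred_forall, Set.ofPred_and]
  exact isClosed_iInter fun i => (isClosed_le continuous_const (hc i)).inter
    (isClosed_le (hc i) continuous_const)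

/-- A direction `d` killed by the rows on which `M y` is integral can be followed both ways from
`y`, as the inequalities in the other rows are strict. -/
lemma extremePoints_roundings_subset {ι : Type*} [Finite ι] {n : ℕ} {M : Matrix ι (Fin n) ℤ}
    (hM : M.IsTotallyUnimodular) (x : Fin n → ℝ) :
    (roundings M x).extremePoints ℝ ⊆ intVectors n := by
  intro y hy
  refine mem_intVectors_of_ker_eq_zero hM y fun d hd => ?_
  have hev : ∀ s : ℝ, ∀ᶠ ε : ℝ in nhds 0, y + (s * ε) • d ∈ roundings M x := fun s => by
    simp only [roundings, Set.mem_ofPred_eq, map_add, map_smul, Pi.add_apply, Pi.smul_apply,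
      smul_eq_mul]
    refine Filter.eventually_all.2 fun i => ?_
    have hyi := hy.1 i
    by_cases hi : ∃ z : ℤ, realMulVec M y i = z
    · simpa [hd i hi] using hyi
    · have h1 := lt_of_le_of_ne hyi.1 fun h => hi ⟨_, h.symm⟩
      have h2 := lt_of_le_of_ne hyi.2 fun h => hi ⟨_, h⟩
      have ht : Filter.Tendsto (fun ε : ℝ => realMulVec M y i + s * ε * realMulVec M d i)
          (nhds 0) (nhds (realMulVec M y i)) := by
        have : Continuous fun ε : ℝ => realMulVec M y i + s * ε * realMulVec M d i := by fun_prop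
        simpa using this.tendsto 0
      filter_upwards [ht.eventually_const_lt h1, ht.eventually_lt_const h2] with ε a b
      exact ⟨a.le, b.le⟩
  obtain ⟨ε, ⟨hp, hm⟩, hε⟩ :=
    (((hev 1).and (hev (-1))).filter_mono nhdsWithin_le_nhds |>.and
      (self_mem_nhdsWithin : Set.Ioi (0 : ℝ) ∈ nhdsWithin 0 (Set.Ioi 0))).exists
  have hmid : y ∈ openSegment ℝ (y + (1 * ε) • d) (y + (-1 * ε) • d) :=
    ⟨1 / 2, 1 / 2, by norm_num, by norm_num, by norm_num, by module⟩
  have := hy.2 hp hm hmid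
  have hz : ε • d = 0 := by simpa using this
  exact (smul_eq_zero.1 hz).resolve_left (ne_of_gt hε)

/-- The unit rows keep the roundings of `x` in a bounded box, so by the Krein–Milman theorem `x` is
a convex combination of extreme points. There are finitely many integral points in the box, hence
no closure is needed. -/
lemma mem_convexHull_roundings {ι : Type*} [Finite ι] {n : ℕ} {M : Matrix ι (Fin n) ℤ}
    (hM : M.IsTotallyUnimodular) (x : Fin n → ℝ) :
    x ∈ convexHull ℝ (roundings (fromRows M (1 : Matrix (Fin n) (Fin n) ℤ)) x ∩ intVectors n) := by
  set K := roundings (fromRows M (1 : Matrix (Fin n) (Fin n) ℤ)) x with hK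
  have hbox : K ⊆ Set.Icc (fun j => (⌊x j⌋ : ℝ)) (fun j => (⌈x j⌉ : ℝ)) := fun y hy => by
    have : ∀ j, (⌊x j⌋ : ℝ) ≤ y j ∧ y j ≤ (⌈x j⌉ : ℝ) := fun j => by
      simpa [realMulVec_apply, one_apply] using hy (Sum.inr j)
    exact ⟨fun j => (this j).1, fun j => (this j).2⟩
  have hcomp : IsCompact K := isCompact_Icc.of_isClosed_subset (isClosed_roundings _ x) hbox
  have hext : K.extremePoints ℝ ⊆ K ∩ intVectors n := fun y hy =>
    ⟨hy.1, extremePoints_roundings_subset ((fromRows_one_isTotallyUnimodular_iff M).2 hM) x hy⟩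
  have hfin : (K ∩ intVectors n).Finite := by
    refine ((Set.finite_Icc (fun j => ⌊x j⌋) (fun j => ⌈x j⌉)).image
      fun (z : Fin n → ℤ) j => (z j : ℝ)).subset ?_
    rintro y ⟨hy, hyz⟩
    obtain ⟨z, rfl⟩ := mem_intVectors_iff.1 hyz
    have := hbox hy
    exact ⟨z, ⟨fun j => Int.cast_le.1 (this.1 j), fun j => Int.cast_le.1 (this.2 j)⟩, rfl⟩
  have hx : x ∈ K := self_mem_roundings _ x
  rw [← closure_convexHull_extremePoints hcomp (convex_roundings _ x)] at hx
  exact closure_minimal (convexHull_mono hext) (hfin.isClosed_convexHull ℝ) hx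

/-! ### Polyhedra and Weyl's theorem -/

/-- A solution set of finitely many linear inequalities `f x ≤ c` in a real vector space, where
`f` is a linear form. -/
def IsPolyhedral {V : Type*} [AddCommGroup V] [Module ℝ V] (S : Set V) : Prop :=
  ∃ s : Finset (Module.Dual ℝ V × ℝ), S = {x | ∀ p ∈ s, p.1 x ≤ p.2}

section Polyhedral

variable {V V' : Type*} [AddCommGroup V] [Module ℝ V] [AddCommGroup V'] [Module ℝ V']

lemma IsPolyhedral.preimage_add_const {S : Set V} (hS : IsPolyhedral S) (f : V' →ₗ[ℝ] V) (v : V) :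
    IsPolyhedral {x | f x + v ∈ S} := by
  classical
  obtain ⟨s, rfl⟩ := hS
  refine ⟨s.image fun p => (p.1 ∘ₗ f, p.2 - p.1 v), ?_⟩
  ext x
  simp only [Set.mem_ofPred_eq, Finset.forall_mem_image, LinearMap.comp_apply, map_add,
    le_sub_iff_add_le]

lemma isPolyhedral_singleton_zero [Module.Finite ℝ V] : IsPolyhedral ({0} : Set V) := by
  classical
  let b := Module.finBasis ℝ V
  refine ⟨Finset.univ.image (fun i => (b.coord i, (0 : ℝ))) ∪
    Finset.univ.image (fun i => (-b.coord i, (0 : ℝ))), ?_⟩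
  ext x
  simp only [Set.mem_singleton_iff, Set.mem_ofPred_eq, Finset.mem_union, or_imp, forall_and,
    Finset.forall_mem_image, Finset.mem_univ, forall_const, LinearMap.neg_apply,
    Module.Basis.coord_apply, neg_nonpos]
  constructor
  · rintro rfl
    simp
  · rintro ⟨h1, h2⟩
    exact b.ext_elem fun i => by simpa using le_antisymm (h1 (x := i)) (h2 (x := i))

lemma exists_between_finsets {α : Type*} [LinearOrder α] [Nonempty α] (L U : Finset α)
    (h : ∀ a ∈ L, ∀ c ∈ U, a ≤ c) : ∃ t, (∀ a ∈ L, a ≤ t) ∧ ∀ c ∈ U, t ≤ c := by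
  rcases L.eq_empty_or_nonempty with rfl | hL
  · obtain ⟨t, ht⟩ := U.bddBelow
    exact ⟨t, by simp, fun c hc => ht hc⟩
  · exact ⟨L.max' hL, fun a ha => L.le_max' a ha, fun c hc => h _ (L.max'_mem hL) c hc⟩

/-- Fourier–Motzkin elimination of one real variable: a constraint bounding it from above is
combined with each one bounding it from below. -/
lemma IsPolyhedral.image_fst {S : Set (V × ℝ)} (hS : IsPolyhedral S) :
    IsPolyhedral (Prod.fst '' S) := by
  classical
  obtain ⟨s, rfl⟩ := hS
  let φ (p : Module.Dual ℝ (V × ℝ) × ℝ) : Module.Dual ℝ V := p.1 ∘ₗ LinearMap.inl ℝ V ℝ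
  let α (p : Module.Dual ℝ (V × ℝ) × ℝ) : ℝ := p.1 (0, 1)
  have hsplit : ∀ p x t, p.1 (x, t) = φ p x + t * α p := fun p x t => by
    have : (x, t) = (x, (0 : ℝ)) + t • ((0 : V), (1 : ℝ)) := by simp
    rw [this, map_add, map_smul]
    rfl
  refine ⟨(s.filter fun p => α p = 0).image (fun p => (φ p, p.2)) ∪
    ((s.filter fun p => α p < 0) ×ˢ (s.filter fun p => 0 < α p)).image
      (fun q => (α q.2 • φ q.1 - α q.1 • φ q.2, α q.2 * q.1.2 - α q.1 * q.2.2)), ?_⟩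
  ext x
  simp only [Set.mem_image, Prod.exists, exists_and_right, exists_eq_right, Set.mem_ofPred_eq,
    Finset.mem_union, or_imp, forall_and, Finset.forall_mem_image, Finset.mem_filter,
    Finset.mem_product, LinearMap.sub_apply, LinearMap.smul_apply, smul_eq_mul, and_imp, hsplit]
  constructor
  · rintro ⟨t, ht⟩
    refine ⟨fun p hp h0 => by simpa [h0] using ht p hp, fun q hq1 hα1 hq2 hα2 => ?_⟩
    nlinarith [mul_le_mul_of_nonneg_left (ht _ hq1) hα2.le,
      mul_le_mul_of_nonneg_left (ht _ hq2) (neg_nonneg.2 hα1.le)]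
  · rintro ⟨h0, h1⟩
    obtain ⟨t, htl, htu⟩ := exists_between_finsets
      ((s.filter fun p => α p < 0).image fun p => (p.2 - φ p x) / α p)
      ((s.filter fun p => 0 < α p).image fun p => (p.2 - φ p x) / α p) (by
        simp only [Finset.forall_mem_image, Finset.mem_filter, and_imp]
        intro p hp hαp q hq hαq
        rw [div_le_iff_of_neg hαp, div_mul_eq_mul_div, div_le_iff₀ hαq]
        have := h1 (x := (p, q)) hp hαp hq hαq
        dsimp only at this
        nlinarith)
    simp only [Finset.forall_mem_image, Finset.mem_filter, and_imp] at htl htu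
    refine ⟨t, fun p hp => ?_⟩
    rcases lt_trichotomy (α p) 0 with h | h | h
    · have := htl hp h
      rw [div_le_iff_of_neg h] at this
      linarith
    · simpa [h] using h0 hp h
    · have := htu hp h
      rw [le_div_iff₀ h] at this
      linarith

/-- Adding a ray `ℝ≥0 r` to a polyhedron is the elimination of `t` from `0 ≤ t`, `x - t r ∈ S`. -/
lemma IsPolyhedral.add_ray {S : Set V} (hS : IsPolyhedral S) (r : V) :
    IsPolyhedral {x | ∃ t : ℝ≥0, x - t • r ∈ S} := by
  classical
  have h1 : IsPolyhedral {q : V × ℝ | 0 ≤ q.2 ∧ q.1 - q.2 • r ∈ S} := by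
    obtain ⟨s, hs⟩ := hS.preimage_add_const
      (LinearMap.fst ℝ V ℝ - (LinearMap.snd ℝ V ℝ).smulRight r) 0
    refine ⟨insert (-LinearMap.snd ℝ V ℝ, 0) s, ?_⟩
    ext q
    have := Set.ext_iff.1 hs q
    simp only [LinearMap.sub_apply, LinearMap.fst_apply, LinearMap.smulRight_apply,
      LinearMap.snd_apply, add_zero, Set.mem_ofPred_eq] at this
    simp only [Set.mem_ofPred_eq, this, Finset.forall_mem_insert, LinearMap.neg_apply,
      LinearMap.snd_apply, neg_nonpos]
  convert h1.image_fst using 1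
  ext x
  constructor
  · rintro ⟨t, ht⟩
    exact ⟨(x, t), ⟨t.2, ht⟩, rfl⟩
  · rintro ⟨⟨_, t⟩, ⟨h0, ht⟩, rfl⟩
    exact ⟨⟨t, h0⟩, ht⟩

/-- Weyl's theorem: finitely generated convex cones are polyhedral. -/
theorem isPolyhedral_span_finset [Module.Finite ℝ V] (G : Finset V) :
    IsPolyhedral (Submodule.span ℝ≥0 (G : Set V) : Set V) := by
  classical
  induction G using Finset.induction_on with
  | empty => simpa using isPolyhedral_singleton_zero
  | insert r G _ ih =>
    convert ih.add_ray r using 1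
    ext x
    simp only [Finset.coe_insert, SetLike.mem_coe, Submodule.mem_span_insert, Set.mem_ofPred_eq]
    exact exists_congr fun t => ⟨fun ⟨z, hz, h⟩ => by simpa [h] using hz,
      fun h => ⟨_, h, by abel⟩⟩

end Polyhedral

lemma IsPolyhedral.isPolyhedron {n : ℕ} {S : Set (Fin n → ℝ)} (hS : IsPolyhedral S) :
    IsPolyhedron S := by
  obtain ⟨s, rfl⟩ := hS
  refine ⟨s.card, LinearMap.toMatrix' (LinearMap.pi fun i => (s.equivFin.symm i).1.1),
    fun i => (s.equivFin.symm i).1.2, ?_⟩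
  ext x
  simp only [Set.mem_ofPred_eq, Pi.le_def, ← Matrix.toLin'_apply, Matrix.toLin'_toMatrix',
    LinearMap.pi_apply]
  exact ⟨fun h i => h _ (s.equivFin.symm i).2, fun h p hp => by
    simpa using h (s.equivFin ⟨p, hp⟩)⟩

/-! ### Integer hulls of polyhedra -/

section IntegerHull

variable {ι : Type*} {n : ℕ}

/-- The real solutions of the integral system `C x ≤ d`. -/
def solutions (C : Matrix ι (Fin n) ℤ) (d : ι → ℤ) : Set (Fin n → ℝ) :=
  {x | ∀ i, realMulVec C x i ≤ (d i : ℝ)}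

/-- The integral points `(x, t)`, `t ≥ 0`, of the homogenized system `C x ≤ t d`. -/
def homogenization (C : Matrix ι (Fin n) ℤ) (d : ι → ℤ) : AddSubmonoid ((Fin n → ℤ) × ℕ) where
  carrier := {q | ∀ i, (C.mulVec q.1) i ≤ q.2 * d i}
  zero_mem' := by simp
  add_mem' {p q} hp hq i := by
    have := add_le_add (hp i) (hq i)
    simpa [Matrix.mulVec_add, add_mul] using this

/-- Splitting `x` into positive and negative parts and adding slacks turns `C x ≤ t d` into a
linear system of equations over `ℕ`, to which Gordan's lemma applies. -/
lemma homogenization_fg [Finite ι] (C : Matrix ι (Fin n) ℤ) (d : ι → ℤ) :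
    (homogenization C d).FG := by
  let f : (Fin n → ℕ) × (Fin n → ℕ) × ℕ × (ι → ℕ) →+ (ι → ℤ) :=
    { toFun := fun q => C.mulVec (fun j => (q.1 j : ℤ) - q.2.1 j) + fun i => (q.2.2.2 i : ℤ)
      map_zero' := by
        ext i
        simp [Matrix.mulVec, dotProduct]
      map_add' := fun p q => by
        have : (fun j => ((p + q).1 j : ℤ) - (p + q).2.1 j) =
            (fun j => (p.1 j : ℤ) - p.2.1 j) + fun j => (q.1 j : ℤ) - q.2.1 j := by
          ext j
          simp only [Prod.fst_add, Prod.snd_add, Pi.add_apply]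
          push_cast
          ring
        rw [this, Matrix.mulVec_add]
        ext i
        simp only [Prod.snd_add, Pi.add_apply]
        push_cast
        ring }
  let g : (Fin n → ℕ) × (Fin n → ℕ) × ℕ × (ι → ℕ) →+ (ι → ℤ) :=
    { toFun := fun q => fun i => (q.2.2.1 : ℤ) * d i
      map_zero' := by ext i; simp
      map_add' := fun p q => by ext i; simp [add_mul] }
  let π : (Fin n → ℕ) × (Fin n → ℕ) × ℕ × (ι → ℕ) →+ (Fin n → ℤ) × ℕ :=
    { toFun := fun q => (fun j => (q.1 j : ℤ) - q.2.1 j, q.2.2.1)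
      map_zero' := by ext <;> simp
      map_add' := fun p q => by
        ext
        · simp only [Prod.fst_add, Prod.snd_add, Pi.add_apply]
          push_cast
          ring
        · simp }
  have : homogenization C d = (f.eqLocusM g).map π := by
    ext ⟨x, t⟩
    simp only [AddSubmonoid.mem_map, AddMonoidHom.mem_eqLocusM]
    constructor
    · intro h
      have hx : (fun j => (((x j).toNat : ℕ) : ℤ) - ((-x j).toNat : ℕ)) = x := by
        ext j
        exact Int.toNat_sub_toNat_neg _
      refine ⟨(fun j => (x j).toNat, fun j => (-x j).toNat, t,
        fun i => (t * d i - C.mulVec x i).toNat), ?_, ?_⟩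
      · ext i
        simp only [f, g, AddMonoidHom.coe_mk, ZeroHom.coe_mk, hx, Pi.add_apply]
        rw [Int.toNat_of_nonneg (sub_nonneg.2 (h i))]
        ring
      · simp only [π, AddMonoidHom.coe_mk, ZeroHom.coe_mk, hx]
    · rintro ⟨q, hq, hπ⟩ i
      have hi := congrFun hq i
      rw [← hπ]
      simp only [f, g, π, AddMonoidHom.coe_mk, ZeroHom.coe_mk, Pi.add_apply] at hi ⊢
      rw [← hi]
      simp
  rw [this]
  exact (AddSubmonoid.fg_eqLocusM f g).map π

/-- Generators with `t ≥ 2` do not contribute to sums with `t ≤ 1`. -/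
lemma mem_closure_filter_snd_le_one {M : Type*} [AddCommMonoid M] {G : Set (M × ℕ)} {q : M × ℕ}
    (hq : q ∈ AddSubmonoid.closure G) (h1 : q.2 ≤ 1) :
    q ∈ AddSubmonoid.closure {g ∈ G | g.2 ≤ 1} := by
  induction hq using AddSubmonoid.closure_induction with
  | mem x hx => exact AddSubmonoid.subset_closure ⟨hx, h1⟩
  | zero => exact zero_mem _
  | add x y _ _ ihx ihy =>
    rw [Prod.snd_add] at h1
    exact add_mem (ihx (by omega)) (ihy (by omega))

/-- The embedding of `ℤⁿ × ℕ` into `ℝⁿ × ℝ`. -/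
def homogenizationCast (n : ℕ) : (Fin n → ℤ) × ℕ →+ (Fin n → ℝ) × ℝ :=
  ((Int.castAddHom ℝ).compLeft (Fin n)).prodMap (Nat.castAddMonoidHom ℝ)

lemma homogenizationCast_apply (q : (Fin n → ℤ) × ℕ) :
    homogenizationCast n q = ((fun j => (q.1 j : ℝ)), (q.2 : ℝ)) := rfl

lemma intCast_mem_solutions_iff {C : Matrix ι (Fin n) ℤ} {d : ι → ℤ} {z : Fin n → ℤ} :
    (fun j => (z j : ℝ)) ∈ solutions C d ↔ (z, 1) ∈ homogenization C d := by
  simp only [solutions, Set.mem_ofPred_eq, realMulVec_intCast, Int.cast_le]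
  exact forall_congr' fun i => by simp

/-- An integral direction `r` with `C r ≤ 0` is a recession direction of the integer hull: for
integral `z`, the point `z + c r` lies between `z + ⌊c⌋ r` and `z + (⌊c⌋ + 1) r`. -/
lemma add_smul_mem_convexHull {C : Matrix ι (Fin n) ℤ} {d : ι → ℤ} {r : Fin n → ℤ}
    (hr : (r, 0) ∈ homogenization C d) {k : Fin n → ℝ}
    (hk : k ∈ convexHull ℝ (solutions C d ∩ intVectors n)) (c : ℝ≥0) :
    k + c • (fun j => (r j : ℝ)) ∈ convexHull ℝ (solutions C d ∩ intVectors n) := by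
  have hconv : Convex ℝ {k : Fin n → ℝ | ∀ c : ℝ≥0,
      k + c • (fun j => (r j : ℝ)) ∈ convexHull ℝ (solutions C d ∩ intVectors n)} := by
    intro k₁ h₁ k₂ h₂ a b ha hb hab c
    convert convex_convexHull ℝ _ (h₁ c) (h₂ c) ha hb hab using 1
    rw [smul_add, smul_add, add_add_add_comm, ← add_smul a b (c • fun j => (r j : ℝ)), hab,
      one_smul]
  refine convexHull_min ?_ hconv hk c
  rintro _ ⟨hz, hzi⟩ c
  obtain ⟨z, rfl⟩ := mem_intVectors_iff.1 hzi
  rw [intCast_mem_solutions_iff] at hz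
  have hmem : ∀ m : ℕ, (fun j => (z j : ℝ)) + (m : ℝ) • (fun j => (r j : ℝ)) ∈
      convexHull ℝ (solutions C d ∩ intVectors n) := fun m => by
    have heq : (fun j => (z j : ℝ)) + (m : ℝ) • (fun j => (r j : ℝ)) =
        fun j => ((z + m • r) j : ℝ) := by
      ext j
      simp
    rw [heq]
    refine subset_convexHull ℝ _ ⟨intCast_mem_solutions_iff.2 ?_, mem_intVectors_iff.2 ⟨_, rfl⟩⟩
    simpa using add_mem hz (nsmul_mem hr m)
  set m := ⌊(c : ℝ)⌋₊
  have h1 : (m : ℝ) ≤ c := Nat.floor_le c.2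
  have h2 : (c : ℝ) < m + 1 := Nat.lt_floor_add_one _
  convert convex_convexHull ℝ _ (hmem m) (hmem (m + 1)) (sub_nonneg.2 h2.le) (sub_nonneg.2 h1)
    (by ring) using 1
  ext j
  simp only [Pi.add_apply, Pi.smul_apply, smul_eq_mul, NNReal.smul_def]
  push_cast
  ring

/-- Points of the cone generated by the homogenization in degrees at most one: at positive height
they are multiples of points of the integer hull, at height zero they are recession directions. -/
lemma span_homogenization_le_one {C : Matrix ι (Fin n) ℤ} {d : ι → ℤ}
    {G : Set ((Fin n → ℤ) × ℕ)} (hG : G ⊆ homogenization C d) (hG1 : ∀ g ∈ G, g.2 ≤ 1)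
    {q : (Fin n → ℝ) × ℝ} (hq : q ∈ Submodule.span ℝ≥0 (homogenizationCast n '' G)) :
    0 ≤ q.2 ∧
      (0 < q.2 → ∃ k ∈ convexHull ℝ (solutions C d ∩ intVectors n), q.1 = q.2 • k) ∧
      (q.2 = 0 → ∀ k ∈ convexHull ℝ (solutions C d ∩ intVectors n), ∀ c : ℝ≥0,
        k + c • q.1 ∈ convexHull ℝ (solutions C d ∩ intVectors n)) := by
  induction hq using Submodule.span_induction with
  | mem x hx =>
    obtain ⟨⟨z, t⟩, hg, rfl⟩ := hx
    have ht : t ≤ 1 := hG1 _ hg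
    interval_cases t
    · simp only [homogenizationCast_apply, Nat.cast_zero, le_refl, lt_self_iff_false,
        false_implies, forall_const, true_and]
      exact fun k hk c => add_smul_mem_convexHull (hG hg) hk c
    · simp only [homogenizationCast_apply, Nat.cast_one, zero_le_one, zero_lt_one, one_ne_zero,
        false_implies, forall_const, true_and, and_true, one_smul]
      exact ⟨_, subset_convexHull ℝ _ ⟨intCast_mem_solutions_iff.2 (hG hg),
        mem_intVectors_iff.2 ⟨_, rfl⟩⟩, rfl⟩
  | zero => simp
  | add x y _ _ hx hy =>
    -- A point `s • k + w` with `w` a recession direction and `s > 0` is `s • (k + s⁻¹ • w)`.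
    have mixed : ∀ x y : (Fin n → ℝ) × ℝ, 0 < x.2 →
        (∃ k ∈ convexHull ℝ (solutions C d ∩ intVectors n), x.1 = x.2 • k) → y.2 = 0 →
        (∀ k ∈ convexHull ℝ (solutions C d ∩ intVectors n), ∀ c : ℝ≥0,
          k + c • y.1 ∈ convexHull ℝ (solutions C d ∩ intVectors n)) →
        ∃ k ∈ convexHull ℝ (solutions C d ∩ intVectors n), (x + y).1 = (x + y).2 • k := by
      rintro x y hx0 ⟨k, hk, hxk⟩ hy0 hy
      refine ⟨_, hy k hk (x.2⁻¹).toNNReal, ?_⟩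
      rw [Prod.fst_add, Prod.snd_add, hy0, add_zero, smul_add, hxk, NNReal.smul_def,
        Real.coe_toNNReal _ (inv_nonneg.2 hx0.le), smul_inv_smul₀ hx0.ne']
    refine ⟨add_nonneg hx.1 hy.1, fun h => ?_, fun h k hk c => ?_⟩
    · rcases hx.1.eq_or_lt with hx0 | hx0 <;> rcases hy.1.eq_or_lt with hy0 | hy0
      · rw [Prod.snd_add, ← hx0, ← hy0, add_zero] at h
        exact absurd h (lt_irrefl _)
      · rw [add_comm]
        exact mixed y x hy0 (hy.2.1 hy0) hx0.symm (hx.2.2 hx0.symm)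
      · exact mixed x y hx0 (hx.2.1 hx0) hy0.symm (hy.2.2 hy0.symm)
      · obtain ⟨k₁, hk₁, h₁⟩ := hx.2.1 hx0
        obtain ⟨k₂, hk₂, h₂⟩ := hy.2.1 hy0
        have hs : (0 : ℝ) < x.2 + y.2 := h
        refine ⟨_, convex_convexHull ℝ _ hk₁ hk₂ (div_nonneg hx0.le hs.le)
          (div_nonneg hy0.le hs.le) (by rw [← add_div, div_self hs.ne']), ?_⟩
        rw [Prod.fst_add, Prod.snd_add, h₁, h₂, smul_add, smul_smul, smul_smul,
          mul_div_cancel₀ _ hs.ne', mul_div_cancel₀ _ hs.ne']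
    · rw [Prod.snd_add] at h
      have hx0 : x.2 = 0 := by linarith [hx.1, hy.1]
      have hy0 : y.2 = 0 := by linarith [hx.1, hy.1]
      rw [Prod.fst_add, smul_add, ← add_assoc]
      exact hy.2.2 hy0 _ (hx.2.2 hx0 k hk c) c
  | smul a x _ hx =>
    rcases eq_or_ne a 0 with rfl | ha
    · simp
    have ha' : (0 : ℝ) < a := NNReal.coe_pos.2 (pos_iff_ne_zero.2 ha)
    simp only [Prod.smul_fst, Prod.smul_snd, NNReal.smul_def, smul_eq_mul]
    refine ⟨mul_nonneg ha'.le hx.1, fun h => ?_, fun h k hk c => ?_⟩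
    · obtain ⟨k, hk, hxk⟩ := hx.2.1 (pos_of_mul_pos_right h ha'.le)
      exact ⟨k, hk, by rw [hxk, smul_smul]⟩
    · have := hx.2.2 ((mul_eq_zero.1 h).resolve_left ha'.ne') k hk (c * a)
      rwa [NNReal.smul_def, NNReal.coe_mul, mul_smul] at this

/-- Meyer's theorem: the integer hull of a polyhedron with integral data is a polyhedron. It is the
section at height one of a finitely generated cone. -/
theorem isPolyhedral_convexHull_solutions [Finite ι] (C : Matrix ι (Fin n) ℤ) (d : ι → ℤ) :
    IsPolyhedral (convexHull ℝ (solutions C d ∩ intVectors n)) := by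
  classical
  obtain ⟨G, hG⟩ := homogenization_fg C d
  have hmem : ∀ g ∈ G, g ∈ homogenization C d := fun g hg => by
    rw [← hG]
    exact AddSubmonoid.subset_closure hg
  let G₁ := G.filter fun g => g.2 ≤ 1
  have h := (isPolyhedral_span_finset (G₁.image (homogenizationCast n))).preimage_add_const
    (LinearMap.inl ℝ (Fin n → ℝ) ℝ) (0, 1)
  rw [Finset.coe_image] at h
  convert h using 1
  refine Set.Subset.antisymm (convexHull_min ?_ ?_) fun x hx => ?_
  · rintro _ ⟨hz, hzi⟩
    obtain ⟨z, rfl⟩ := mem_intVectors_iff.1 hzi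
    rw [intCast_mem_solutions_iff, ← hG] at hz
    have hz1 := AddSubmonoid.mem_map_of_mem (homogenizationCast n)
      (mem_closure_filter_snd_le_one hz le_rfl)
    rw [AddMonoidHom.map_mclosure] at hz1
    have hle : AddSubmonoid.closure (homogenizationCast n '' (G₁ : Set ((Fin n → ℤ) × ℕ))) ≤
        (Submodule.span ℝ≥0 (homogenizationCast n '' G₁)).toAddSubmonoid :=
      AddSubmonoid.closure_le.2 Submodule.subset_span
    have := hle (by simpa [G₁] using hz1)
    simpa [homogenizationCast_apply] using this
  · intro x hx y hy a b ha hb hab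
    lift a to ℝ≥0 using ha
    lift b to ℝ≥0 using hb
    have := add_mem (Submodule.smul_mem _ a hx) (Submodule.smul_mem _ b hy)
    simpa [NNReal.smul_def, hab] using this
  · have := (span_homogenization_le_one (fun g hg => hmem g (Finset.mem_filter.1 hg).1)
      (fun g hg => (Finset.mem_filter.1 hg).2) hx).2.1
    simpa using this

end IntegerHull

/-! ### The affine TU decomposition -/

/-- The bounds `ℓ ≤ x ≤ u` become inequalities of an integral system, with the trivial row `0 ≤ 0`
in place of an infinite bound. -/
lemma exists_feasible_eq_solutions {m n : ℕ} (A : Matrix (Fin m) (Fin n) ℤ) (b : Fin m → ℤ)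
    (l : Fin n → WithBot ℤ) (u : Fin n → WithTop ℤ) :
    ∃ (C : Matrix (Fin m ⊕ Fin n ⊕ Fin n) (Fin n) ℤ) (d : Fin m ⊕ Fin n ⊕ Fin n → ℤ),
      feasible A b l u = solutions C d := by
  refine ⟨Matrix.of (Sum.elim A (Sum.elim
      (fun i => if l i = ⊥ then 0 else Pi.single i (-1))
      (fun i => if u i = ⊤ then 0 else Pi.single i 1))),
    Sum.elim b (Sum.elim (fun i => -(l i).unbotD 0) (fun i => (u i).untopD 0)), ?_⟩
  ext x
  simp only [feasible, solutions, act_eq_realMulVec, realMulVec_apply, Set.mem_ofPred_eq,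
    Sum.forall, Matrix.of_apply, Sum.elim_inl, Sum.elim_inr]
  have hl : ∀ i, (∀ a : ℤ, l i = (a : WithBot ℤ) → (a : ℝ) ≤ x i) ↔
      ∑ j, (((if l i = ⊥ then 0 else Pi.single i (-1) : Fin n → ℤ) j : ℤ) : ℝ) * x j ≤
        ((-(l i).unbotD 0 : ℤ) : ℝ) := fun i => by
    cases h : l i with
    | bot => simp
    | coe a => simp [Pi.single_apply]
  have hu : ∀ i, (∀ c : ℤ, u i = (c : WithTop ℤ) → x i ≤ (c : ℝ)) ↔
      ∑ j, (((if u i = ⊤ then 0 else Pi.single i 1 : Fin n → ℤ) j : ℤ) : ℝ) * x j ≤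
        (((u i).untopD 0 : ℤ) : ℝ) := fun i => by
    cases h : u i with
    | top => simp
    | coe a => simp [Pi.single_apply]
  simp only [forall_congr' hl, forall_congr' hu]
  tauto

/-- A rounding of `x` with respect to `[Ã; W; I]` agrees with `x` on the rows of `W`, hence
satisfies `Ã y ≤ b - U W x`, that is, `A y ≤ b`. -/
lemma roundings_subset_feasible {m n k : ℕ} {A At : Matrix (Fin m) (Fin n) ℤ}
    {U : Matrix (Fin m) (Fin k) ℤ} {W : Matrix (Fin k) (Fin n) ℤ} (hA : A = At + U * W)
    {b : Fin m → ℤ} {l : Fin n → WithBot ℤ} {u : Fin n → WithTop ℤ} {x : Fin n → ℝ}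
    (hx : x ∈ feasible A b l u) (hWx : act W x ∈ intVectors k) :
    roundings (Matrix.fromRows (Matrix.fromRows At W) (1 : Matrix (Fin n) (Fin n) ℤ)) x ⊆
      feasible A b l u := by
  intro y hy
  have hAt : ∀ i, realMulVec At y i ≤ (⌈realMulVec At x i⌉ : ℝ) := fun i => by
    simpa [realMulVec_apply] using (hy (Sum.inl (Sum.inl i))).2
  have hW : realMulVec W y = realMulVec W x := funext fun i => by
    have h : (⌊realMulVec W x i⌋ : ℝ) ≤ realMulVec W y i ∧
        realMulVec W y i ≤ (⌈realMulVec W x i⌉ : ℝ) := by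
      simpa [realMulVec_apply] using hy (Sum.inl (Sum.inr i))
    obtain ⟨z, hz⟩ := hWx i
    rw [act_eq_realMulVec] at hz
    rw [hz, Int.floor_intCast, Int.ceil_intCast] at h
    rw [hz]
    exact le_antisymm h.2 h.1
  have hbox : ∀ j, (⌊x j⌋ : ℝ) ≤ y j ∧ y j ≤ (⌈x j⌉ : ℝ) := fun j => by
    simpa [realMulVec_apply, Matrix.one_apply] using hy (Sum.inr j)
  have hdec : ∀ v, realMulVec A v =
      realMulVec At v + (U.map fun z : ℤ => (z : ℝ)).mulVec (realMulVec W v) := fun v => by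
    have : A.map (fun z : ℤ => (z : ℝ)) = At.map (fun z : ℤ => (z : ℝ)) +
        U.map (fun z : ℤ => (z : ℝ)) * W.map (fun z : ℤ => (z : ℝ)) := by
      rw [hA]
      ext i j
      simp [Matrix.mul_apply]
    simp only [realMulVec, Matrix.mulVecLin_apply, Matrix.mulVec_mulVec, this, Matrix.add_mulVec]
  refine ⟨fun i a ha => ?_, fun i c hc => ?_, fun j => ?_⟩
  · exact le_trans (Int.cast_le.2 (Int.le_floor.2 (hx.1 i a ha))) (hbox i).1
  · exact (hbox i).2.trans (Int.cast_le.2 (Int.ceil_le.2 (hx.2.1 i c hc)))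
  · have hxj := hx.2.2 j
    choose z hz using hWx
    have hz' : realMulVec W x = fun i => (z i : ℝ) := funext hz
    have hU : (U.map fun z : ℤ => (z : ℝ)).mulVec (fun i => (z i : ℝ)) j =
        ((U.mulVec z j : ℤ) : ℝ) := realMulVec_intCast U z j
    rw [act_eq_realMulVec, hdec, Pi.add_apply, hz', hU] at hxj
    rw [act_eq_realMulVec, hdec, Pi.add_apply, hW, hz', hU]
    have hceil : ⌈realMulVec At x j⌉ ≤ b j - U.mulVec z j := Int.ceil_le.2 (by
      push_cast
      linarith)
    have := (hAt j).trans (Int.cast_le.2 hceil)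
    push_cast at this
    linarith

end AffineTU

theorem theorem1 {m n k : ℕ} (A At : Matrix (Fin m) (Fin n) ℤ)
    (U : Matrix (Fin m) (Fin k) ℤ) (W : Matrix (Fin k) (Fin n) ℤ)
    (hdec : AffineTU.IsAffineTUDecomposition A At U W)
    (b : Fin m → ℤ) (l : Fin n → WithBot ℤ) (u : Fin n → WithTop ℤ)
    (hlu : AffineTU.BoundsLE l u) :
    AffineTU.IsIntegralPolyhedron
        (convexHull ℝ {x | x ∈ AffineTU.feasible A b l u ∧
          AffineTU.act W x ∈ AffineTU.intVectors k}) ∧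
      convexHull ℝ (AffineTU.feasible A b l u ∩ AffineTU.intVectors n) =
        convexHull ℝ {x | x ∈ AffineTU.feasible A b l u ∧
          AffineTU.act W x ∈ AffineTU.intVectors k} := by
  have hsub : AffineTU.feasible A b l u ∩ AffineTU.intVectors n ⊆
      {x | x ∈ AffineTU.feasible A b l u ∧ AffineTU.act W x ∈ AffineTU.intVectors k} := by
    rintro x ⟨hx, hxi⟩
    obtain ⟨z, rfl⟩ := AffineTU.mem_intVectors_iff.1 hxi
    exact ⟨hx, fun i => ⟨_, AffineTU.realMulVec_intCast W z i⟩⟩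
  have heq : convexHull ℝ (AffineTU.feasible A b l u ∩ AffineTU.intVectors n) =
      convexHull ℝ {x | x ∈ AffineTU.feasible A b l u ∧
        AffineTU.act W x ∈ AffineTU.intVectors k} := by
    refine (convexHull_mono hsub).antisymm (convexHull_min ?_ (convex_convexHull ℝ _))
    rintro x ⟨hx, hWx⟩
    exact convexHull_mono (Set.inter_subset_inter_left _
      (AffineTU.roundings_subset_feasible hdec.eq_add_mul hx hWx))
      (AffineTU.mem_convexHull_roundings hdec.totallyUnimodular x)
  refine ⟨⟨?_, ?_⟩, heq⟩
  · rw [← heq]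
    obtain ⟨C, d, hCd⟩ := AffineTU.exists_feasible_eq_solutions A b l u
    rw [hCd]
    exact (AffineTU.isPolyhedral_convexHull_solutions C d).isPolyhedron
  · refine Set.Subset.antisymm ?_ (convexHull_min Set.inter_subset_left (convex_convexHull ℝ _))
    conv_lhs => rw [← heq]
    exact convexHull_mono fun x hx => ⟨subset_convexHull ℝ _ (hsub hx), hx.2⟩
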